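/- Let $n\in\mathbb N$, let $K=[-1,1]^n\subseteq\mathbb R^n$ be equipped with the Lebesgue measure, and for a polynomial $f\in\mathbb R[x_1,\dots,x_n]$ write $f_{\min,K}=\min_{x\in K}f(x)$, $$\beta_{K,f}=\max_{x\in K}\|\nabla f(x)\|,\qquad \gamma_{K,f}=\tfrac12\max_{x\in K}\|\nabla^2 f(x)\|$$ (Euclidean norm, resp. the associated operator norm). For $r\in\mathbb N$ let $\Sigma_r$ be the set of sums of squares of real polynomials in $n$ variables that have degree at most $2r$, and let $$f^{(r)}=\inf\Big\{\int_K f(x)q(x)\,dx \;:\; q\in\Sigma_r,\ \int_K q(x)\,dx=1\Big\},\qquad E^{(r)}_K(f)=f^{(r)}-f_{\min,K}.$$ Then $E^{(r)}_K(f)=O(1/r^2)$, where the constant depends only on $n$, $\beta_{K,f}$ and $\gamma_{K,f}$ (in particular, not on the position of a global minimizer of $f$ on $K$): for every $n$ there is a function $c:\mathbb R\times\mathbb R\to(0,\infty)$ such that for every polynomial $f\in\mathbb R[x_1,\dots,x_n]$ and every integer $r\ge 1$, $$E^{(r)}_K(f)\;\le\;\frac{c(\beta_{K,f},\gamma_{K,f})}{r^2}.$$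 -/

import Mathlib

open MeasureTheory

noncomputable section

/-- The polynomial function on `ℝⁿ` (with its Euclidean norm) attached to `f ∈ ℝ[x₁, …, xₙ]`. -/
def polyFun {n : ℕ} (f : MvPolynomial (Fin n) ℝ) (x : EuclideanSpace ℝ (Fin n)) : ℝ :=
  MvPolynomial.eval (fun i => x i) f

/-- The minimum of `f` over `K`. -/
def polyMin {n : ℕ} (K : Set (EuclideanSpace ℝ (Fin n))) (f : MvPolynomial (Fin n) ℝ) : ℝ :=
  sInf (polyFun f '' K)

/-- `Σ_r`: the sums of squares of polynomials that have degree at most `2r`. -/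
def sosCone (n r : ℕ) : Set (MvPolynomial (Fin n) ℝ) :=
  {q | IsSumSq q ∧ q.totalDegree ≤ 2 * r}

/-- The measure-based upper bound
`f^{(r)} = inf { ∫_K f q dμ : q ∈ Σ_r, ∫_K q dμ = 1 }`. -/
def lasserreBound {n : ℕ} (K : Set (EuclideanSpace ℝ (Fin n)))
    (μ : Measure (EuclideanSpace ℝ (Fin n))) (f : MvPolynomial (Fin n) ℝ) (r : ℕ) : ℝ :=
  sInf {v : ℝ | ∃ q ∈ sosCone n r,
    ∫ x in K, polyFun q x ∂μ = 1 ∧ v = ∫ x in K, polyFun f x * polyFun q x ∂μ}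

/-- The error `E^{(r)}_{K,μ}(f) = f^{(r)} - f_{min,K}`. -/
def lasserreError {n : ℕ} (K : Set (EuclideanSpace ℝ (Fin n)))
    (μ : Measure (EuclideanSpace ℝ (Fin n))) (f : MvPolynomial (Fin n) ℝ) (r : ℕ) : ℝ :=
  lasserreBound K μ f r - polyMin K f

/-- `β_{K,f} = max_{x ∈ K} ‖∇f(x)‖`. -/
def gradConst {n : ℕ} (K : Set (EuclideanSpace ℝ (Fin n))) (f : MvPolynomial (Fin n) ℝ) : ℝ :=
  sSup ((fun x => ‖gradient (polyFun f) x‖) '' K)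

/-- `γ_{K,f} = ½ max_{x ∈ K} ‖∇²f(x)‖`: the Hessian is the derivative of the gradient, and the norm
is its operator norm with respect to the Euclidean norm. -/
def hessConst {n : ℕ} (K : Set (EuclideanSpace ℝ (Fin n))) (f : MvPolynomial (Fin n) ℝ) : ℝ :=
  (1 / 2 : ℝ) * sSup ((fun x => ‖fderiv ℝ (gradient (polyFun f)) x‖) '' K)

/-- The hypercube `[-1,1]ⁿ`. -/
def hypercube (n : ℕ) : Set (EuclideanSpace ℝ (Fin n)) :=
  {x | ∀ i, x i ∈ Set.Icc (-1 : ℝ) 1}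

end

/-! At a minimizer `a` of `f` on the cube, Taylor's formula gives `f x ≤ f a + ∑ i, (b i * (x i - a
i) + γ * (x i - a i) ^ 2)` with `b = ∇f(a)`. This majorant is separable, so a product of univariate
squared densities reduces the error to a sum of one-dimensional moments.

First-order optimality leaves two cases per coordinate. If `b i = 0`, only the second moment about
`a i` matters, and concentration at scale `1/N` makes it `O(1/N²)`, wherever `a i` lies. If `b i ≠
0`, then `a i` is an endpoint, where polynomials of degree `O(N)` concentrate at the finer scale
`1/N²`, so the first moment is `O(1/N²)` too. `exists_univariate_density` covers both cases, with
constants independent of `a`; both densities are fourth powers of one Fejér-type kernel composed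
with a polynomial. -/

/-! ### Univariate kernels and densities. -/

open Polynomial in
/-- A Fejér-type polynomial: `R = (1 - T_N) / (N² (1 - X))` with `N = m + 1`. -/
theorem exists_fejer_polynomial (m : ℕ) :
    ∃ R : ℝ[X], R.natDegree ≤ m ∧ ∀ w ∈ Set.Icc (0 : ℝ) 2,
      0 ≤ R.eval (1 - w) ∧ (1 + (m + 1 : ℝ) ^ 2 * w) * R.eval (1 - w) ≤ 5 ∧
        ((m + 1 : ℝ) ^ 2 * w ≤ 2 → 1 / 4 ≤ R.eval (1 - w)) := by
  set N : ℝ := (m + 1 : ℝ) with hN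
  have hN1 : 1 ≤ N := by rw [hN]; have := Nat.cast_nonneg (α := ℝ) m; linarith
  have hN0 : 0 < N := by linarith
  set T : ℝ[X] := Chebyshev.T ℝ ((m + 1 : ℕ) : ℤ) with hT
  have hroot : IsRoot (C 1 - T) 1 := by simp [IsRoot, hT]
  set Q : ℝ[X] := (C 1 - T) /ₘ (X - C 1) with hQ
  have hQmul : (X - C 1) * Q = C 1 - T := mul_divByMonic_eq_iff_isRoot.2 hroot
  have hdeg : Q.natDegree ≤ m := by
    rw [hQ, natDegree_divByMonic _ (monic_X_sub_C 1), natDegree_X_sub_C]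
    have h : (C 1 - T).natDegree ≤ m + 1 := by
      refine (natDegree_sub_le _ _).trans ?_
      simp only [hT, natDegree_C, Chebyshev.natDegree_T]; omega
    omega
  have hRw : ∀ w : ℝ, N ^ 2 * w * (C (-(1 / N ^ 2)) * Q).eval (1 - w) = 1 - T.eval (1 - w) := by
    intro w
    have h := congrArg (eval (1 - w)) hQmul
    simp only [eval_mul, eval_sub, eval_X, eval_C] at h ⊢
    rw [← h]; field_simp; ring
  refine ⟨C (-(1 / N ^ 2)) * Q, (natDegree_C_mul_le _ _).trans hdeg, ?_⟩
  set R : ℝ[X] := C (-(1 / N ^ 2)) * Q with hR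
  have hcont : Continuous fun w : ℝ => R.eval (1 - w) := by fun_prop
  have hpi : Real.pi ^ 2 < 10 := by
    have := Real.pi_lt_d2; have := Real.pi_pos; nlinarith
  -- With `1 - w = cos t` the kernel is `(1 - cos (N t)) / (N² w)`; `w = 0` is excluded here and
  -- recovered below by continuity.
  have key : ∀ w ∈ Set.Ioc (0 : ℝ) 2, 0 ≤ R.eval (1 - w) ∧ (1 + N ^ 2 * w) * R.eval (1 - w) ≤ 5 ∧
        (N ^ 2 * w ≤ 2 → 1 / 4 ≤ R.eval (1 - w)) := by
    rintro w ⟨hw0, hw2⟩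
    set t := Real.arccos (1 - w) with ht
    have hcos : Real.cos t = 1 - w := Real.cos_arccos (by linarith) (by linarith)
    have ht0 : 0 ≤ t := Real.arccos_nonneg _
    have htpi : t ≤ Real.pi := Real.arccos_le_pi _
    have hTt : T.eval (1 - w) = Real.cos (N * t) := by
      rw [← hcos, hT, Chebyshev.T_real_cos]; simp [hN]
    have e := hRw w
    rw [hTt] at e
    have hNw : 0 < N ^ 2 * w := by positivity
    have hR0 : 0 ≤ R.eval (1 - w) := by
      by_contra hneg
      have := mul_neg_of_pos_of_neg hNw (not_le.1 hneg)
      have := Real.cos_le_one (N * t); linarith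
    have htw : 2 / Real.pi ^ 2 * t ^ 2 ≤ w := by
      have := Real.cos_le_one_sub_mul_cos_sq (x := t) (by rw [abs_of_nonneg ht0]; exact htpi)
      linarith
    have htw' : t ^ 2 / 5 ≤ w := by
      refine le_trans ?_ htw
      have : (1 / 5 : ℝ) ≤ 2 / Real.pi ^ 2 := by
        rw [div_le_div_iff₀ (by norm_num) (by positivity)]; linarith
      nlinarith [sq_nonneg t]
    have hwt : w ≤ t ^ 2 / 2 := by have := Real.one_sub_sq_div_two_le_cos (x := t); linarith
    refine ⟨hR0, ?_, fun hsmall => ?_⟩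
    -- `N² w R = 1 - cos (N t) ≤ 2`, and `R ≤ 5/2` from `1 - cos (N t) ≤ (N t)²/2` and `w ≥ t²/5`.
    · have h1 := Real.neg_one_le_cos (N * t)
      have h2 : R.eval (1 - w) ≤ 5 / 2 := by
        have h3 := Real.one_sub_sq_div_two_le_cos (x := N * t)
        by_contra hlt
        have := mul_lt_mul_of_pos_left (not_le.1 hlt) hNw
        have : N ^ 2 * (t ^ 2 / 5) ≤ N ^ 2 * w := by gcongr
        nlinarith
      linarith
    -- The range `N t ≤ π` is where `1 - cos (N t) ≥ (2/π²) (N t)²` is available; with `w ≤ t²/2` it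
    -- gives even `R ≥ 2/5`.
    · have hNt : N * t ≤ Real.pi := by
        refine le_of_sq_le_sq ?_ Real.pi_pos.le
        have h : 2 / Real.pi ^ 2 * (N * t) ^ 2 ≤ 2 := by
          calc 2 / Real.pi ^ 2 * (N * t) ^ 2 = N ^ 2 * (2 / Real.pi ^ 2 * t ^ 2) := by ring
            _ ≤ N ^ 2 * w := by gcongr
            _ ≤ 2 := hsmall
        rw [div_mul_eq_mul_div, div_le_iff₀ (by positivity)] at h
        linarith
      have h := Real.cos_le_one_sub_mul_cos_sq (x := N * t)
        (by rw [abs_of_nonneg (by positivity)]; exact hNt)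
      have h5 : (1 / 5 : ℝ) ≤ 2 / Real.pi ^ 2 := by
        rw [div_le_div_iff₀ (by norm_num) (by positivity)]; linarith
      have h6 : 1 / 5 * (N * t) ^ 2 ≤ 2 / Real.pi ^ 2 * (N * t) ^ 2 := by gcongr
      by_contra hlt
      have := mul_lt_mul_of_pos_left (not_le.1 hlt) hNw
      have : N ^ 2 * w ≤ N ^ 2 * (t ^ 2 / 2) := by gcongr
      nlinarith [sq_nonneg (N * t)]
  have hcl : closure (Set.Ioc (0 : ℝ) 2) = Set.Icc 0 2 := closure_Ioc (by norm_num)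
  have hcl' : closure (Set.Ioc (0 : ℝ) (2 / N ^ 2)) = Set.Icc 0 (2 / N ^ 2) :=
    closure_Ioc (by positivity)
  intro w hw
  refine ⟨?_, ?_, fun hs => ?_⟩
  · exact le_on_closure (s := Set.Ioc (0 : ℝ) 2) (fun x hx => (key x hx).1) (by fun_prop)
      hcont.continuousOn (hcl ▸ hw)
  · exact le_on_closure (s := Set.Ioc (0 : ℝ) 2) (fun x hx => (key x hx).2.1)
      (by fun_prop) (by fun_prop) (hcl ▸ hw)
  · refine le_on_closure (s := Set.Ioc (0 : ℝ) (2 / N ^ 2)) (fun x hx => (key x ⟨hx.1, ?_⟩).2.2 ?_)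
      (by fun_prop) hcont.continuousOn (x := w) ?_
    · refine hx.2.trans (div_le_self (by norm_num) ?_)
      nlinarith
    · have := hx.2; rwa [le_div_iff₀ (by positivity), mul_comm] at this
    · rw [hcl']; exact ⟨hw.1, by rwa [le_div_iff₀ (by positivity), mul_comm]⟩

/-- For every point `a` of `[-1,1]` a square concentrated around `a` at scale `1/(m+1)`. -/
theorem exists_square_concentrated (m : ℕ) {a : ℝ} (ha : a ∈ Set.Icc (-1 : ℝ) 1) :
    ∃ p : Polynomial ℝ, p.natDegree ≤ 4 * m ∧
      1 / (256 * (m + 1 : ℝ)) ≤ ∫ x in (-1 : ℝ)..1, p.eval x ^ 2 ∧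
      ∫ x in (-1 : ℝ)..1, (x - a) ^ 2 * p.eval x ^ 2 ≤ 10000 / (m + 1 : ℝ) ^ 3 := by
  obtain ⟨R, hdeg, hR⟩ := exists_fejer_polynomial m
  set N : ℝ := (m + 1 : ℝ) with hN
  have hN1 : 1 ≤ N := by rw [hN]; have := Nat.cast_nonneg (α := ℝ) m; linarith
  have hN0 : 0 < N := by linarith
  obtain ⟨ha1, ha2⟩ := ha
  set L : Polynomial ℝ := 1 - Polynomial.C (1 / 2) * (Polynomial.X - Polynomial.C a) ^ 2 with hL
  have hev : ∀ x, ((R.comp L) ^ 2).eval x = R.eval (1 - (x - a) ^ 2 / 2) ^ 2 := by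
    intro x
    have : L.eval x = 1 - (x - a) ^ 2 / 2 := by simp [hL]; ring
    rw [Polynomial.eval_pow, Polynomial.eval_comp, this]
  have hw : ∀ x ∈ Set.Icc (-1 : ℝ) 1, (x - a) ^ 2 / 2 ∈ Set.Icc (0 : ℝ) 2 := by
    rintro x ⟨h1, h2⟩
    exact ⟨by positivity, by nlinarith⟩
  refine ⟨(R.comp L) ^ 2, ?_, ?_, ?_⟩
  · have hLd : L.natDegree ≤ 2 := by rw [hL]; compute_degree
    calc ((R.comp L) ^ 2).natDegree ≤ 2 * (R.comp L).natDegree := Polynomial.natDegree_pow_le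
      _ ≤ 2 * (R.natDegree * L.natDegree) := by gcongr; exact Polynomial.natDegree_comp_le
      _ ≤ 2 * (m * 2) := by gcongr
      _ = 4 * m := by ring
  · have hN1' : 1 / N ≤ 1 := by rw [div_le_one hN0]; exact hN1
    have hNp : 0 < 1 / N := by positivity
    -- An interval of length `1/N` with `a` as an end, on the side where `[-1,1]` has room.
    obtain ⟨s, hs1, hs2, hs3⟩ : ∃ s : ℝ, -1 ≤ s ∧ s + 1 / N ≤ 1 ∧
        ∀ x ∈ Set.Icc s (s + 1 / N), |x - a| ≤ 1 / N := by
      rcases le_total a 0 with h | h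
      · exact ⟨a, ha1, by linarith, fun x hx => abs_le.2 ⟨by linarith [hx.1], by linarith [hx.2]⟩⟩
      · exact ⟨a - 1 / N, by linarith, by linarith,
          fun x hx => abs_le.2 ⟨by linarith [hx.1], by linarith [hx.2]⟩⟩
    calc 1 / (256 * N) = ∫ x in s..(s + 1 / N), (1 / 256 : ℝ) := by
          simp only [intervalIntegral.integral_const, smul_eq_mul]; field_simp; ring
      _ ≤ ∫ x in s..(s + 1 / N), ((R.comp L) ^ 2).eval x ^ 2 := by
          refine intervalIntegral.integral_mono_on (by linarith) (by simp)
            (Continuous.intervalIntegrable (by fun_prop) _ _) fun x hx => ?_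
          have hq : 1 / 4 ≤ R.eval (1 - (x - a) ^ 2 / 2) := by
            refine (hR _ (hw x ⟨by linarith [hx.1], by linarith [hx.2]⟩)).2.2 ?_
            have h := sq_le_sq' (by linarith [(abs_le.1 (hs3 x hx)).1]) (abs_le.1 (hs3 x hx)).2
            calc N ^ 2 * ((x - a) ^ 2 / 2) ≤ N ^ 2 * ((1 / N) ^ 2 / 2) := by gcongr
              _ ≤ 2 := by field_simp; norm_num
          rw [hev]
          calc (1 / 256 : ℝ) = ((1 / 4) ^ 2) ^ 2 := by norm_num
            _ ≤ _ := by gcongr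
      _ ≤ ∫ x in (-1 : ℝ)..1, ((R.comp L) ^ 2).eval x ^ 2 := by
          refine intervalIntegral.integral_mono_interval hs1 (by linarith) hs2
            (Filter.Eventually.of_forall fun x => by positivity)
            (Continuous.intervalIntegrable (by fun_prop) _ _)
  -- Decay of the kernel bounds the integrand by a Cauchy kernel, whose integral is an arctangent
  -- difference below `π ≤ 4`.
  · have hc : Continuous fun x : ℝ => 2500 / N ^ 2 * (1 + (N * (x - a)) ^ 2)⁻¹ := by
      refine continuous_const.mul (Continuous.inv₀ (by fun_prop) fun x => by positivity)
    calc ∫ x in (-1 : ℝ)..1, (x - a) ^ 2 * ((R.comp L) ^ 2).eval x ^ 2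
        ≤ ∫ x in (-1 : ℝ)..1, 2500 / N ^ 2 * (1 + (N * (x - a)) ^ 2)⁻¹ := by
          refine intervalIntegral.integral_mono_on (by norm_num)
            (Continuous.intervalIntegrable (by fun_prop) _ _) (hc.intervalIntegrable _ _)
            fun x hx => ?_
          obtain ⟨h0, h1, -⟩ := hR _ (hw x hx)
          rw [hev]
          set u := R.eval (1 - (x - a) ^ 2 / 2)
          have hz : 0 ≤ N ^ 2 * ((x - a) ^ 2 / 2) := by positivity
          have hu5 : u ≤ 5 := by nlinarith
          have hzu : N ^ 2 * ((x - a) ^ 2 / 2) * u ≤ 5 := by nlinarith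
          have hb : (1 + (N * (x - a)) ^ 2) * u ≤ 10 := by nlinarith
          rw [div_mul_eq_mul_div, le_div_iff₀ (by positivity), ← div_eq_mul_inv,
            le_div_iff₀ (by positivity)]
          calc (x - a) ^ 2 * (u ^ 2) ^ 2 * N ^ 2 * (1 + (N * (x - a)) ^ 2)
              = 2 * (N ^ 2 * ((x - a) ^ 2 / 2) * u) * u ^ 2 * ((1 + (N * (x - a)) ^ 2) * u) := by
                ring
            _ ≤ 2 * 5 * 5 ^ 2 * 10 := by gcongr
            _ = 2500 := by norm_num
      _ = 2500 / N ^ 2 * (N⁻¹ * (Real.arctan (N * (1 - a)) - Real.arctan (N * (-1 - a)))) := by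
          rw [intervalIntegral.integral_const_mul]
          congr 1
          have := intervalIntegral.integral_comp_mul_sub (a := -1) (b := 1)
            (fun y : ℝ => (1 + y ^ 2)⁻¹) hN0.ne' (N * a)
          simp only [← mul_sub, integral_inv_one_add_sq, smul_eq_mul] at this
          exact this
      _ ≤ 2500 / N ^ 2 * (N⁻¹ * 4) := by
          gcongr
          have := Real.arctan_lt_pi_div_two (N * (1 - a))
          have := Real.neg_pi_div_two_lt_arctan (N * (-1 - a))
          linarith [Real.pi_le_four]
      _ = 10000 / N ^ 3 := by field_simp; norm_num

/-- Squares concentrated at the endpoint `e = ±1` at scale `1/(m+1)²`. -/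
theorem exists_square_concentrated_endpoint (m : ℕ) {e : ℝ} (he : e = 1 ∨ e = -1) :
    ∃ p : Polynomial ℝ, p.natDegree ≤ 4 * m ∧
      1 / (128 * (m + 1 : ℝ) ^ 2) ≤ ∫ x in (-1 : ℝ)..1, p.eval x ^ 2 ∧
      ∫ x in (-1 : ℝ)..1, (1 - e * x) * p.eval x ^ 2 ≤ 625 / (m + 1 : ℝ) ^ 4 := by
  obtain ⟨R, hdeg, hR⟩ := exists_fejer_polynomial m
  set N : ℝ := (m + 1 : ℝ) with hN
  have hN1 : 1 ≤ N := by rw [hN]; have := Nat.cast_nonneg (α := ℝ) m; linarith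
  have hN0 : 0 < N := by linarith
  have hsub : ∀ g : ℝ → ℝ, ∫ x in (-1 : ℝ)..1, g (1 - e * x) = ∫ w in (0 : ℝ)..2, g w := by
    intro g
    rcases he with rfl | rfl
    · norm_num
    · norm_num
  set L : Polynomial ℝ := Polynomial.C e * Polynomial.X with hL
  have hev : ∀ x, ((R.comp L) ^ 2).eval x = R.eval (1 - (1 - e * x)) ^ 2 := by
    intro x
    simp [hL]
  -- The square matters: with `p = R.comp L`, the decay `R ≤ 5/(1 + N² w)` would leave a logarithm
  -- in the first moment.
  refine ⟨(R.comp L) ^ 2, ?_, ?_, ?_⟩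
  · have hLd : L.natDegree ≤ 1 := by rw [hL]; compute_degree
    calc ((R.comp L) ^ 2).natDegree ≤ 2 * (R.comp L).natDegree := Polynomial.natDegree_pow_le
      _ ≤ 2 * (R.natDegree * L.natDegree) := by gcongr; exact Polynomial.natDegree_comp_le
      _ ≤ 2 * (m * 1) := by gcongr
      _ ≤ 4 * m := by omega
  · simp only [hev]
    rw [hsub fun w => (R.eval (1 - w) ^ 2) ^ 2]
    have hN2 : 2 / N ^ 2 ≤ 2 := div_le_self (by norm_num) (by nlinarith)
    calc 1 / (128 * N ^ 2) = ∫ x in (0 : ℝ)..(2 / N ^ 2), (1 / 256 : ℝ) := by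
          simp only [intervalIntegral.integral_const, smul_eq_mul]; field_simp; norm_num
      _ ≤ ∫ w in (0 : ℝ)..(2 / N ^ 2), (R.eval (1 - w) ^ 2) ^ 2 := by
          refine intervalIntegral.integral_mono_on (by positivity) (by simp)
            (Continuous.intervalIntegrable (by fun_prop) _ _) fun w hw => ?_
          have hq : 1 / 4 ≤ R.eval (1 - w) := by
            refine (hR w ⟨hw.1, hw.2.trans hN2⟩).2.2 ?_
            have := hw.2
            rwa [le_div_iff₀ (by positivity), mul_comm] at this
          calc (1 / 256 : ℝ) = ((1 / 4) ^ 2) ^ 2 := by norm_num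
            _ ≤ _ := by gcongr
      _ ≤ ∫ w in (0 : ℝ)..2, (R.eval (1 - w) ^ 2) ^ 2 := by
          refine intervalIntegral.integral_mono_interval le_rfl (by positivity) hN2
            (Filter.Eventually.of_forall fun x => by positivity)
            (Continuous.intervalIntegrable (by fun_prop) _ _)
  · simp only [hev]
    rw [hsub fun w => w * (R.eval (1 - w) ^ 2) ^ 2]
    have hint : IntervalIntegrable (fun w : ℝ => 1 / (1 + N ^ 2 * w) ^ 2) volume 0 2 := by
      refine ContinuousOn.intervalIntegrable ?_
      rw [Set.uIcc_of_le (by norm_num)]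
      refine ContinuousOn.div (by fun_prop) (by fun_prop) fun w hw => ?_
      have := hw.1
      positivity
    have hFTC : ∫ w in (0 : ℝ)..2, 1 / (1 + N ^ 2 * w) ^ 2 = 2 / (1 + N ^ 2 * 2) := by
      rw [intervalIntegral.integral_eq_sub_of_hasDerivAt (f := fun w => w / (1 + N ^ 2 * w)) _ hint]
      · simp
      · intro w hw
        rw [Set.uIcc_of_le (by norm_num)] at hw
        have hpos : 1 + N ^ 2 * w ≠ 0 := by have := hw.1; positivity
        convert! (hasDerivAt_id w).div (((hasDerivAt_id w).const_mul (N ^ 2)).const_add 1) hpos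
          using 1
        simp only [id_eq, one_mul, mul_one]
        congr 1
        ring
    calc ∫ w in (0 : ℝ)..2, w * (R.eval (1 - w) ^ 2) ^ 2
        ≤ ∫ w in (0 : ℝ)..2, 625 / N ^ 2 * (1 / (1 + N ^ 2 * w) ^ 2) := by
          refine intervalIntegral.integral_mono_on (by norm_num)
            (Continuous.intervalIntegrable (by fun_prop) _ _) (hint.const_mul _) fun w hw => ?_
          obtain ⟨h0, h1, -⟩ := hR w hw
          have hw0 := hw.1
          set u := R.eval (1 - w)
          have hz : 0 ≤ N ^ 2 * w := by positivity
          have hu5 : u ≤ 5 := by nlinarith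
          have hzu : N ^ 2 * w * u ≤ 5 := by nlinarith
          rw [div_mul_div_comm, mul_one, le_div_iff₀ (by positivity)]
          calc w * (u ^ 2) ^ 2 * (N ^ 2 * (1 + N ^ 2 * w) ^ 2)
              = (N ^ 2 * w * u) * u * ((1 + N ^ 2 * w) * u) ^ 2 := by ring
            _ ≤ 5 * 5 * 5 ^ 2 := by gcongr
            _ = 625 := by norm_num
      _ = 625 / N ^ 2 * (2 / (1 + N ^ 2 * 2)) := by
          rw [intervalIntegral.integral_const_mul, hFTC]
      _ ≤ 625 / N ^ 2 * (1 / N ^ 2) := by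
          gcongr 625 / N ^ 2 * ?_
          rw [div_le_div_iff₀ (by positivity) (by positivity)]
          linarith
      _ = 625 / N ^ 4 := by field_simp

/-- Univariate densities for a minimizer `a` with directional slope `b`. -/
theorem exists_univariate_density (m : ℕ) {a b : ℝ} (ha : a ∈ Set.Icc (-1 : ℝ) 1)
    (hb : ∀ x ∈ Set.Icc (-1 : ℝ) 1, 0 ≤ b * (x - a)) :
    ∃ p : Polynomial ℝ, p.natDegree ≤ 4 * m ∧
      ∫ x in (-1 : ℝ)..1, p.eval x ^ 2 = 1 ∧
      ∫ x in (-1 : ℝ)..1, (x - a) ^ 2 * p.eval x ^ 2 ≤ 2560000 / (m + 1 : ℝ) ^ 2 ∧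
      ∫ x in (-1 : ℝ)..1, b * (x - a) * p.eval x ^ 2 ≤ |b| * (2560000 / (m + 1 : ℝ) ^ 2) := by
  have hN0 : (0 : ℝ) < m + 1 := by positivity
  -- Dividing `p` by the square root of its mass keeps the density a square and divides every moment
  -- by the mass.
  have normalize : ∀ p : Polynomial ℝ, 0 < ∫ x in (-1 : ℝ)..1, p.eval x ^ 2 →
      ∃ q : Polynomial ℝ, q.natDegree ≤ p.natDegree ∧ ∀ g : ℝ → ℝ,
        ∫ x in (-1 : ℝ)..1, g x * q.eval x ^ 2 =
          (∫ x in (-1 : ℝ)..1, g x * p.eval x ^ 2) / ∫ x in (-1 : ℝ)..1, p.eval x ^ 2 := by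
    intro p hp
    refine ⟨Polynomial.C (√(∫ x in (-1 : ℝ)..1, p.eval x ^ 2))⁻¹ * p,
      Polynomial.natDegree_C_mul_le _ _, fun g => ?_⟩
    rw [← intervalIntegral.integral_div]
    congr 1 with x
    rw [Polynomial.eval_mul, Polynomial.eval_C, mul_pow, inv_pow, Real.sq_sqrt hp.le]
    field_simp
  by_cases hb0 : b = 0
  · obtain ⟨p, hd, h1, h2⟩ := exists_square_concentrated m ha
    have hp : 0 < ∫ x in (-1 : ℝ)..1, p.eval x ^ 2 := lt_of_lt_of_le (by positivity) h1
    obtain ⟨q, hq, hI⟩ := normalize p hp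
    refine ⟨q, hq.trans hd, ?_, ?_, ?_⟩
    · simpa [hp.ne'] using hI fun _ => 1
    · rw [hI fun x => (x - a) ^ 2, div_le_iff₀ hp]
      refine h2.trans ?_
      calc 10000 / (m + 1 : ℝ) ^ 3 = 2560000 / (m + 1 : ℝ) ^ 2 * (1 / (256 * (m + 1 : ℝ))) := by
            field_simp; norm_num
        _ ≤ _ := by gcongr
    · simp [hb0]
  · obtain ⟨e, he, hae, hbe⟩ : ∃ e : ℝ, (e = 1 ∨ e = -1) ∧ a = e ∧ ∀ x, b * (x - a) = |b| * (1 - e * x) := by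
      have h1 := hb 1 (by norm_num)
      have h2 := hb (-1) (by norm_num)
      obtain ⟨ha1, ha2⟩ := ha
      rcases lt_or_gt_of_ne hb0 with h | h
      · have : a = 1 := by nlinarith
        exact ⟨1, Or.inl rfl, this, fun x => by rw [abs_of_neg h, this]; ring⟩
      · have : a = -1 := by nlinarith
        exact ⟨-1, Or.inr rfl, this, fun x => by rw [abs_of_pos h, this]; ring⟩
    obtain ⟨p, hd, h1, h2⟩ := exists_square_concentrated_endpoint m he
    have hp : 0 < ∫ x in (-1 : ℝ)..1, p.eval x ^ 2 := lt_of_lt_of_le (by positivity) h1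
    obtain ⟨q, hq, hI⟩ := normalize p hp
    have hmain : ∫ x in (-1 : ℝ)..1, (1 - e * x) * q.eval x ^ 2 ≤ 80000 / (m + 1 : ℝ) ^ 2 := by
      rw [hI fun x => 1 - e * x, div_le_iff₀ hp]
      refine h2.trans ?_
      calc 625 / (m + 1 : ℝ) ^ 4 = 80000 / (m + 1 : ℝ) ^ 2 * (1 / (128 * (m + 1 : ℝ) ^ 2)) := by
            field_simp; norm_num
        _ ≤ _ := by gcongr
    refine ⟨q, hq.trans hd, ?_, ?_, ?_⟩
    · simpa [hp.ne'] using hI fun _ => 1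
    -- Here `(x - e)² = (1 - e x)² ≤ 2 (1 - e x)`, so the first moment controls the second.
    · calc ∫ x in (-1 : ℝ)..1, (x - a) ^ 2 * q.eval x ^ 2
          ≤ ∫ x in (-1 : ℝ)..1, 2 * ((1 - e * x) * q.eval x ^ 2) := by
            refine intervalIntegral.integral_mono_on (by norm_num)
              (Continuous.intervalIntegrable (by fun_prop) _ _)
              (Continuous.intervalIntegrable (by fun_prop) _ _) fun x hx => ?_
            rw [← mul_assoc]
            gcongr
            obtain ⟨hx1, hx2⟩ := hx
            rcases he with rfl | rfl <;> rw [hae] <;> nlinarith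
        _ = 2 * ∫ x in (-1 : ℝ)..1, (1 - e * x) * q.eval x ^ 2 :=
            intervalIntegral.integral_const_mul _ _
        _ ≤ 2 * (80000 / (m + 1 : ℝ) ^ 2) := by gcongr
        _ ≤ 2560000 / (m + 1 : ℝ) ^ 2 := by rw [← mul_div_assoc]; gcongr; norm_num
    · simp only [hbe, mul_assoc]
      rw [intervalIntegral.integral_const_mul]
      gcongr
      refine hmain.trans ?_
      gcongr
      norm_num

/-! ### Geometry of the cube and Fubini. -/

theorem hypercube_eq_preimage (n : ℕ) : hypercube n =
    (MeasurableEquiv.toLp 2 (Fin n → ℝ)).symm ⁻¹' Set.univ.pi fun _ => Set.Icc (-1 : ℝ) 1 := by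
  ext x
  simp [hypercube, -Set.mem_Icc, -Set.pi_univ_Icc]

theorem convex_hypercube (n : ℕ) : Convex ℝ (hypercube n) := by
  intro x hx y hy s t hs ht hst i
  simpa using (convex_Icc (-1 : ℝ) 1) (hx i) (hy i) hs ht hst

theorem isCompact_hypercube (n : ℕ) : IsCompact (hypercube n) := by
  have h : hypercube n = (EuclideanSpace.equiv (Fin n) ℝ).toHomeomorph ⁻¹'
      Set.univ.pi fun _ => Set.Icc (-1 : ℝ) 1 := by
    ext x
    simp [hypercube, -Set.mem_Icc, -Set.pi_univ_Icc]
  rw [h, Homeomorph.isCompact_preimage]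
  exact isCompact_univ_pi fun _ => isCompact_Icc

theorem hypercube_nonempty (n : ℕ) : (hypercube n).Nonempty := ⟨0, fun i => by simp⟩

/-- Fubini on the cube for products of univariate functions. -/
theorem setIntegral_hypercube_prod {n : ℕ} (h : Fin n → ℝ → ℝ) :
    ∫ x in hypercube n, ∏ i, h i (x i) = ∏ i, ∫ t in (-1 : ℝ)..1, h i t := by
  have key := (EuclideanSpace.volume_preserving_symm_measurableEquiv_toLp
    (Fin n)).setIntegral_preimage_emb (MeasurableEquiv.measurableEmbedding _)
    (fun y => ∏ i, h i (y i)) (Set.univ.pi fun _ => Set.Icc (-1 : ℝ) 1)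
  rw [← hypercube_eq_preimage, volume_pi, Measure.restrict_pi_pi,
    integral_fintype_prod_eq_prod] at key
  simp only [integral_Icc_eq_integral_Ioc] at key
  simp only [intervalIntegral.integral_of_le (show (-1 : ℝ) ≤ 1 by norm_num)]
  exact key

/-- All factors but the `j`-th integrate to `1`: this is the marginal of the product density. -/
theorem setIntegral_hypercube_prod_of_integral_eq_one {n : ℕ} {q : Fin n → ℝ → ℝ}
    (hq : ∀ i, ∫ t in (-1 : ℝ)..1, q i t = 1) (j : Fin n) (g : ℝ → ℝ) :
    ∫ x in hypercube n, g (x j) * ∏ i, q i (x i) = ∫ t in (-1 : ℝ)..1, g t * q j t := by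
  have h := setIntegral_hypercube_prod fun i t => (if i = j then g t else 1) * q i t
  rw [Finset.prod_eq_single j (fun i _ hij => by simp [hij, hq]) (by simp)] at h
  simp only [Finset.prod_mul_distrib, Finset.prod_ite_eq', Finset.mem_univ, if_true] at h
  exact h

/-! ### Smoothness, Taylor bound and first-order optimality. -/

theorem contDiff_polyFun {n : ℕ} (f : MvPolynomial (Fin n) ℝ) : ContDiff ℝ 2 (polyFun f) := by
  have h : AnalyticOnNhd ℝ (polyFun f) Set.univ := by
    have := AnalyticOnNhd.aeval_mvPolynomial (𝕜 := ℝ) (s := Set.univ)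
      (f := fun (x : EuclideanSpace ℝ (Fin n)) i => x i)
      (fun i => (EuclideanSpace.proj i : EuclideanSpace ℝ (Fin n) →L[ℝ] ℝ).analyticOnNhd _) f
    simp only [MvPolynomial.aeval_eq_eval] at this
    exact this
  exact h.contDiff

theorem continuous_polyFun {n : ℕ} (f : MvPolynomial (Fin n) ℝ) : Continuous (polyFun f) :=
  (contDiff_polyFun f).continuous

theorem contDiff_gradient {F : Type*} [NormedAddCommGroup F] [InnerProductSpace ℝ F]
    [CompleteSpace F] {f : F → ℝ} (hf : ContDiff ℝ 2 f) : ContDiff ℝ 1 (gradient f) := by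
  unfold gradient
  exact (InnerProductSpace.toDual ℝ F).symm.contDiff.comp (hf.fderiv_right (by norm_num))

/-- Second-order Taylor upper bound on a convex set. -/
theorem le_add_inner_gradient_add_sq {F : Type*} [NormedAddCommGroup F] [InnerProductSpace ℝ F]
    [CompleteSpace F] {f : F → ℝ} (hf : ContDiff ℝ 2 f) {s : Set F} (hs : Convex ℝ s) {M : ℝ}
    (hM : ∀ x ∈ s, ‖fderiv ℝ (gradient f) x‖ ≤ 2 * M) {a x : F} (ha : a ∈ s) (hx : x ∈ s) :
    f x ≤ f a + inner ℝ (gradient f a) (x - a) + M * ‖x - a‖ ^ 2 := by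
  set v := x - a with hv
  have hd : ∀ y, DifferentiableAt ℝ f y := fun y => hf.differentiable (by norm_num) y
  have hdg : ∀ y, DifferentiableAt ℝ (gradient f) y :=
    fun y => (contDiff_gradient hf).differentiable (by norm_num) y
  have hφ : ∀ t : ℝ, HasDerivAt
      (fun t : ℝ => f (a + t • v) - t * inner ℝ (gradient f a) v - M * ‖v‖ ^ 2 * t ^ 2)
      (inner ℝ (gradient f (a + t • v)) v - inner ℝ (gradient f a) v - M * ‖v‖ ^ 2 * (2 * t)) t := by
    intro t
    have h1 : HasDerivAt (fun t : ℝ => a + t • v) v t := by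
      simpa using ((hasDerivAt_id t).smul_const v).const_add a
    have h2 := (hd (a + t • v)).hasFDerivAt.comp_hasDerivAt t h1
    rw [← inner_gradient_left] at h2
    have h3 := (hasDerivAt_id t).mul_const (inner ℝ (gradient f a) v)
    have h4 := ((hasDerivAt_id t).pow 2).const_mul (M * ‖v‖ ^ 2)
    convert! (h2.sub h3).sub h4 using 1
    simp
  -- The gradient is `2M`-Lipschitz on `s`, so the remainder along the segment from `a` to `x` is
  -- nonincreasing.
  have hanti := antitoneOn_of_deriv_nonpos (convex_Icc (0 : ℝ) 1)
    (fun t _ => (hφ t).continuousAt.continuousWithinAt)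
    (fun t _ => (hφ t).differentiableAt.differentiableWithinAt) (fun t ht => by
      rw [interior_Icc] at ht
      rw [(hφ t).deriv]
      have hmem : a + t • v ∈ s := hs.add_smul_sub_mem ha hx ⟨ht.1.le, ht.2.le⟩
      have h1 := hs.norm_image_sub_le_of_norm_fderiv_le (fun y _ => hdg y) hM ha hmem
      have h2 := real_inner_le_norm (gradient f (a + t • v) - gradient f a) v
      rw [inner_sub_left] at h2
      rw [add_sub_cancel_left, norm_smul, Real.norm_of_nonneg ht.1.le] at h1
      have h3 := mul_le_mul_of_nonneg_right h1 (norm_nonneg v)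
      linarith)
  have h := hanti (Set.left_mem_Icc.2 zero_le_one) (Set.right_mem_Icc.2 zero_le_one) zero_le_one
  simp only [one_smul, zero_smul, add_zero, hv, add_sub_cancel] at h
  linarith

/-- First-order optimality at a minimizer over the cube, coordinate by coordinate. -/
theorem gradient_mul_sub_nonneg_of_isMinOn {n : ℕ} {f : EuclideanSpace ℝ (Fin n) → ℝ}
    {a : EuclideanSpace ℝ (Fin n)} (hf : DifferentiableAt ℝ f a) (ha : a ∈ hypercube n)
    (hmin : IsMinOn f (hypercube n) a) (i : Fin n) {t : ℝ} (ht : t ∈ Set.Icc (-1 : ℝ) 1) :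
    0 ≤ gradient f a i * (t - a i) := by
  have hy : a + EuclideanSpace.single i (t - a i) ∈ hypercube n := by
    intro j
    by_cases hj : j = i
    · subst hj; simpa using ht
    · simpa [hj] using ha j
  have h := hmin.localize.hasFDerivWithinAt_nonneg hf.hasFDerivAt.hasFDerivWithinAt
    (sub_mem_posTangentConeAt_of_segment_subset ((convex_hypercube n).segment_subset ha hy))
  rw [add_sub_cancel_left, ← inner_gradient_left, EuclideanSpace.inner_single_right] at h
  simpa [mul_comm] using h

/-! ### Sum-of-squares densities and the error bound. -/

theorem totalDegree_aeval_X_le {σ R : Type*} [CommRing R] [Nontrivial R] (i : σ) (p : Polynomial R) :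
    (Polynomial.aeval (MvPolynomial.X i : MvPolynomial σ R) p).totalDegree ≤ p.natDegree := by
  rw [Polynomial.aeval_eq_sum_range]
  refine MvPolynomial.totalDegree_finsetSum_le fun k hk => ?_
  refine (MvPolynomial.totalDegree_smul_le _ _).trans ?_
  exact (MvPolynomial.totalDegree_X_pow i k).le.trans (Nat.lt_succ_iff.1 (Finset.mem_range.1 hk))

theorem polyFun_nonneg_of_isSumSq {n : ℕ} {q : MvPolynomial (Fin n) ℝ} (hq : IsSumSq q)
    (x : EuclideanSpace ℝ (Fin n)) : 0 ≤ polyFun q x := by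
  induction hq using IsSumSq.rec' with
  | zero => simp [polyFun]
  | sq_add hx _ ih =>
    obtain ⟨y, rfl⟩ := hx
    simp only [polyFun, map_add, map_mul] at ih ⊢
    exact add_nonneg (mul_self_nonneg _) ih

/-- Every density in the cone bounds the Lasserre bound from above, as `K` is compact. -/
theorem lasserreBound_le {n r : ℕ} {K : Set (EuclideanSpace ℝ (Fin n))} (hK : IsCompact K)
    {f q : MvPolynomial (Fin n) ℝ} (hq : q ∈ sosCone n r) (h1 : ∫ x in K, polyFun q x = 1) :
    lasserreBound K volume f r ≤ ∫ x in K, polyFun f x * polyFun q x := by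
  refine csInf_le ?_ ⟨q, hq, h1, rfl⟩
  obtain ⟨c, hc⟩ := (hK.image (continuous_polyFun f)).bddBelow
  refine ⟨c, ?_⟩
  rintro v ⟨p, hp, hp1, rfl⟩
  have hcp := continuous_polyFun p
  have hcf := continuous_polyFun f
  calc c = ∫ x in K, c * polyFun p x := by rw [integral_const_mul, hp1, mul_one]
    _ ≤ ∫ x in K, polyFun f x * polyFun p x := by
      refine setIntegral_mono_on ((hcp.const_mul c).continuousOn.integrableOn_compact hK)
        ((hcf.mul hcp).continuousOn.integrableOn_compact hK) hK.measurableSet fun x hx => ?_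
      exact mul_le_mul_of_nonneg_right (hc ⟨x, hx, rfl⟩) (polyFun_nonneg_of_isSumSq hp.1 x)

/-- The error bound in terms of the scale `m` of the univariate densities. -/
theorem lasserreError_hypercube_le (n m r : ℕ) (hr : n * (4 * m) ≤ r)
    (f : MvPolynomial (Fin n) ℝ) :
    lasserreError (hypercube n) volume f r ≤
      n * ((gradConst (hypercube n) f + hessConst (hypercube n) f) *
        (2560000 / (m + 1 : ℝ) ^ 2)) := by
  set K := hypercube n
  set β := gradConst K f with hβ
  set γ := hessConst K f with hγ
  have hK : IsCompact K := isCompact_hypercube n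
  have hf := contDiff_polyFun f
  have hg := contDiff_gradient hf
  obtain ⟨a, haK, hmin⟩ := hK.exists_isMinOn (hypercube_nonempty n) hf.continuous.continuousOn
  have hpm : polyMin K f = polyFun f a :=
    IsLeast.csInf_eq ⟨⟨a, haK, rfl⟩, by rintro _ ⟨x, hx, rfl⟩; exact hmin hx⟩
  set b := gradient (polyFun f) a with hb
  have hbβ : ∀ i, |b i| ≤ β := fun i => (PiLp.norm_apply_le b i).trans
    (le_csSup (hK.image hg.continuous.norm).bddAbove ⟨a, haK, rfl⟩)
  have hγb : ∀ x ∈ K, ‖fderiv ℝ (gradient (polyFun f)) x‖ ≤ 2 * γ := by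
    intro x hx
    have h := le_csSup (hK.image (hg.continuous_fderiv (by norm_num)).norm).bddAbove
      ⟨x, hx, rfl⟩
    rw [hγ, hessConst]
    linarith
  have hγ0 : 0 ≤ γ := by
    have := (norm_nonneg _).trans (hγb a haK)
    linarith
  choose p hpd hp1 hp2 hp3 using fun i => exists_univariate_density m (haK i) fun t ht =>
    gradient_mul_sub_nonneg_of_isMinOn (hf.differentiable (by norm_num) a) haK hmin i ht
  set P : MvPolynomial (Fin n) ℝ := ∏ i, Polynomial.aeval (MvPolynomial.X i) (p i) with hP
  have hq : ∀ x, polyFun (P * P) x = ∏ i, (p i).eval (x i) ^ 2 := by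
    intro x
    have h : MvPolynomial.eval (fun i => x i) P = ∏ i, (p i).eval (x i) := by
      rw [hP, map_prod]
      refine Finset.prod_congr rfl fun i _ => ?_
      rw [← MvPolynomial.aeval_eq_eval, ← Polynomial.aeval_algHom_apply]
      simp
    rw [polyFun, map_mul, h, Finset.prod_pow, sq]
  have hqd : P * P ∈ sosCone n r := by
    refine ⟨IsSumSq.mul_self P, (MvPolynomial.totalDegree_mul _ _).trans ?_⟩
    have : P.totalDegree ≤ n * (4 * m) := by
      refine (MvPolynomial.totalDegree_finsetProd _ _).trans ?_
      refine (Finset.sum_le_sum fun i _ => (totalDegree_aeval_X_le i (p i)).trans (hpd i)).trans ?_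
      simp
    omega
  have hq1 : ∫ x in K, polyFun (P * P) x = 1 := by
    simp only [hq]
    rw [setIntegral_hypercube_prod fun i t => (p i).eval t ^ 2]
    simp [hp1]
  have hint : ∀ {g : EuclideanSpace ℝ (Fin n) → ℝ}, Continuous g →
      IntegrableOn g K := fun hg => hg.continuousOn.integrableOn_compact hK
  have hqc : Continuous fun x : EuclideanSpace ℝ (Fin n) => ∏ i, (p i).eval (x i) ^ 2 := by
    fun_prop
  have hterm : ∀ (i : Fin n) (g : ℝ → ℝ), Continuous g →
      Continuous fun x : EuclideanSpace ℝ (Fin n) => g (x i) * ∏ i, (p i).eval (x i) ^ 2 :=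
    fun i g hg => (hg.comp (by fun_prop)).mul hqc
  rw [lasserreError, hpm, sub_le_iff_le_add']
  refine (lasserreBound_le hK hqd hq1).trans ?_
  have hsum : ∀ x : EuclideanSpace ℝ (Fin n),
      polyFun f a + inner ℝ b (x - a) + γ * ‖x - a‖ ^ 2 =
        polyFun f a + ∑ i, (b i * (x i - a i) + γ * (x i - a i) ^ 2) := by
    intro x
    rw [EuclideanSpace.norm_sq_eq, PiLp.inner_apply, Finset.sum_add_distrib, Finset.mul_sum,
      ← add_assoc]
    simp [mul_comm]
  calc ∫ x in K, polyFun f x * polyFun (P * P) x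
      ≤ ∫ x in K, (polyFun f a * polyFun (P * P) x + ∑ i : Fin n,
          (b i * (x i - a i) + γ * (x i - a i) ^ 2) * ∏ j, (p j).eval (x j) ^ 2) := by
        refine setIntegral_mono_on (hint ((continuous_polyFun _).mul (continuous_polyFun _)))
          (hint (((continuous_polyFun _).const_mul _).add (continuous_finsetSum _ fun i _ =>
            hterm i (fun t => b i * (t - a i) + γ * (t - a i) ^ 2) (by fun_prop))))
          hK.measurableSet fun x hx => ?_
        rw [← Finset.sum_mul, ← hq, ← add_mul, ← hsum]
        exact mul_le_mul_of_nonneg_right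
          (le_add_inner_gradient_add_sq hf (convex_hypercube n) hγb haK hx)
          (polyFun_nonneg_of_isSumSq hqd.1 x)
    _ = polyFun f a + ∑ i : Fin n, ∫ t in (-1 : ℝ)..1,
          (b i * (t - a i) + γ * (t - a i) ^ 2) * (p i).eval t ^ 2 := by
        rw [integral_add (hint ((continuous_polyFun _).const_mul _))
          (hint (continuous_finsetSum _ fun i _ =>
            hterm i (fun t => b i * (t - a i) + γ * (t - a i) ^ 2) (by fun_prop))),
          integral_const_mul, hq1, mul_one, integral_finsetSum _ fun i _ => hint
            (hterm i (fun t => b i * (t - a i) + γ * (t - a i) ^ 2) (by fun_prop))]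
        congr 1
        exact Finset.sum_congr rfl fun i _ => setIntegral_hypercube_prod_of_integral_eq_one
          (q := fun i t => (p i).eval t ^ 2) hp1 i
          fun t => b i * (t - a i) + γ * (t - a i) ^ 2
    _ ≤ polyFun f a + ∑ i : Fin n, (β + γ) * (2560000 / (m + 1 : ℝ) ^ 2) := by
        gcongr with i
        calc ∫ t in (-1 : ℝ)..1, (b i * (t - a i) + γ * (t - a i) ^ 2) * (p i).eval t ^ 2
            = (∫ t in (-1 : ℝ)..1, b i * (t - a i) * (p i).eval t ^ 2) +
              γ * ∫ t in (-1 : ℝ)..1, (t - a i) ^ 2 * (p i).eval t ^ 2 := by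
              rw [← intervalIntegral.integral_const_mul, ← intervalIntegral.integral_add
                (Continuous.intervalIntegrable (by fun_prop) _ _)
                (Continuous.intervalIntegrable (by fun_prop) _ _)]
              congr 1 with t
              ring
          _ ≤ |b i| * (2560000 / (m + 1 : ℝ) ^ 2) + γ * (2560000 / (m + 1 : ℝ) ^ 2) :=
              add_le_add (hp3 i) (mul_le_mul_of_nonneg_left (hp2 i) hγ0)
          _ ≤ (β + γ) * (2560000 / (m + 1 : ℝ) ^ 2) := by
              rw [add_mul]
              gcongr
              exact hbβ i
    _ = _ := by simp

theorem mainTheorem2 (n : ℕ) :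
    ∃ c : ℝ → ℝ → ℝ, (∀ β γ : ℝ, 0 < c β γ) ∧
      ∀ (f : MvPolynomial (Fin n) ℝ) (r : ℕ), 1 ≤ r →
        lasserreError (hypercube n) volume f r ≤
          c (gradConst (hypercube n) f) (hessConst (hypercube n) f) / (r : ℝ) ^ 2 := by
  -- The factor `(4n)²` converts `m + 1` into `r`; the absolute values and `+ 1` make `c` positive
  -- at all real arguments.
  refine ⟨fun β γ => n * (|β| + |γ|) * 2560000 * (4 * n) ^ 2 + 1, fun β γ => by positivity,
    fun f r hr => ?_⟩
  have hr0 : (0 : ℝ) < r := by exact_mod_cast hr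
  set β := gradConst (hypercube n) f
  set γ := hessConst (hypercube n) f
  -- The largest `m` with `4nm ≤ r`; for `n = 0` division by zero gives `m = 0`, and the error bound
  -- is then `0`.
  set m := r / (4 * n) with hm
  have h1 : n * (4 * m) ≤ r := by
    have := Nat.mul_div_le r (4 * n)
    rw [hm]
    linarith [mul_assoc 4 n (r / (4 * n)), mul_left_comm n 4 (r / (4 * n))]
  refine (lasserreError_hypercube_le n m r h1 f).trans ?_
  rcases Nat.eq_zero_or_pos n with hn | hn
  · subst hn
    simp only [Nat.cast_zero, zero_mul]
    positivity
  have h2 : (r : ℝ) ≤ 4 * n * (m + 1 : ℝ) := by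
    have := Nat.lt_mul_div_succ r (show 0 < 4 * n by omega)
    exact_mod_cast this.le
  rw [le_div_iff₀ (by positivity)]
  calc n * ((β + γ) * (2560000 / (m + 1 : ℝ) ^ 2)) * (r : ℝ) ^ 2
      ≤ n * ((|β| + |γ|) * (2560000 / (m + 1 : ℝ) ^ 2)) * (4 * n * (m + 1 : ℝ)) ^ 2 := by
        gcongr <;> exact le_abs_self _
    _ = n * (|β| + |γ|) * 2560000 * (4 * n) ^ 2 := by field_simp
    _ ≤ n * (|β| + |γ|) * 2560000 * (4 * n) ^ 2 + 1 := by linarith
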